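/- A Stone space is a compact Hausdorff space with a basis of clopen sets. A topological monoid $S$ is called r-NA (right non-archimedean) if the right action of $S$ on itself by multiplication has a proper $S$-compactification which is a Stone space, that is, if there are a Stone space $Y$, a (jointly) continuous right monoid action $Y\times S\to Y$ and a topological embedding $\nu\colon S\to Y$ with dense range such that $\nu(xs)=\nu(x)s$ for all $x,s\in S$. Let $S$ be an r-NA topological monoid. Then for every NA valued field $(F,|\cdot|)$ (a field with a multiplicative absolute value satisfying $|a+b|\le\max\{|a|,|b|\}$) there exists an ultra-normed $F$-vector space $(V,\|\cdot\|)$ (that is, $\|\cdot\|$ is a norm with $\|\lambda v\|=|\lambda|\,\|v\|$ and $\|v+w\|\le\max\{\|v\|,\|w\|\}$) such that $S$ is a topological submonoid of $\Theta_{lin}(V)$, i.e. there is an identity-preserving monoid homomorphism $S\to\Theta_{lin}(V)$ which is a topological embedding. Here $\Theta_{lin}(V)$ is the monoid under composition of all nonexpansive $F$-linear operators $V\to V$, equipped with the strong operator topology (the topology of pointwise convergence on $V$ with respect to the norm). -/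

import Mathlib

open Topology

universe u v

/-- A Stone space: a compact Hausdorff space whose clopen subsets form a basis of the topology. -/
structure IsStoneSpace (Y : Type u) [TopologicalSpace Y] : Prop where
  compact : CompactSpace Y
  hausdorff : T2Space Y
  zeroDimensional : TopologicalSpace.IsTopologicalBasis {U : Set Y | IsClopen U}

/-- A proper `S`-compactification `ν : X → Y` with `Y` a Stone space: `Y` is a Stone space with a
jointly continuous action of `S`, and `ν` is an equivariant topological embedding with dense
range. -/
structure IsProperStoneCompactification (S : Type v) [Monoid S] [TopologicalSpace S]
    {X : Type u} [TopologicalSpace X] [MulAction S X]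
    {Y : Type u} [TopologicalSpace Y] [MulAction S Y] (ν : X → Y) : Prop where
  stone : IsStoneSpace Y
  continuous_action : Continuous fun p : S × Y => p.1 • p.2
  embedding : IsEmbedding ν
  dense : DenseRange ν
  equivariant : ∀ (s : S) (x : X), ν (s • x) = s • ν x

/-- A monoid action `S × X → X` is non-archimedean if it is continuous and admits a proper
`S`-compactification which is a Stone space. A Hausdorff space with a dense subspace `X` embeds as
a set into the set of filters on `X`, so restricting `Y` to the universe of `X` loses nothing. -/
def IsNonarchimedeanAction (S : Type v) [Monoid S] [TopologicalSpace S]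
    (X : Type u) [TopologicalSpace X] [MulAction S X] : Prop :=
  (Continuous fun p : S × X => p.1 • p.2) ∧
    ∃ (Y : Type u) (_ : TopologicalSpace Y) (_ : MulAction S Y) (ν : X → Y),
      IsProperStoneCompactification S ν

/-- A topological monoid `S` is r-NA (right non-archimedean) if the right action of `S` on itself
by multiplication is non-archimedean. Right actions of `S` are left actions of `Sᵐᵒᵖ`, and here
`MulOpposite.op s • x = x * s`. -/
def IsRightNonarchimedean (S : Type u) [Monoid S] [TopologicalSpace S] : Prop :=
  IsNonarchimedeanAction Sᵐᵒᵖ S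

/-- The monoid (under composition) of all nonexpansive `F`-linear operators `V → V`. -/
def ThetaLin (F : Type v) [NormedField F] (V : Type u) [NormedAddCommGroup V] [NormedSpace F V] :
    Submonoid (Module.End F V) where
  carrier := {σ | ∀ x y : V, dist (σ x) (σ y) ≤ dist x y}
  one_mem' := fun _ _ => le_rfl
  mul_mem' := fun {σ τ} hσ hτ x y => (hσ (τ x) (τ y)).trans (hτ x y)

/-- The strong operator topology: the topology of pointwise convergence inherited from the product
topology of `V → V`. -/
instance ThetaLin.strongOperatorTopology (F : Type v) [NormedField F] (V : Type u)
    [NormedAddCommGroup V] [NormedSpace F V] : TopologicalSpace (ThetaLin F V) :=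
  TopologicalSpace.induced (fun (σ : ThetaLin F V) (x : V) => (σ : Module.End F V) x)
    Pi.topologicalSpace

/-!
Let `ν : S → Y` be a proper Stone compactification of the right action of `S` on itself. The space
`V` is `C(Y, F)` with the supremum norm, which is ultrametric because the norm of `F` is. The monoid
`S` acts on `V` by `(s f)(y) = f (y s)`; these operators are linear and nonexpansive, and two
reversals of order (right action, precomposition) make `s ↦ (f ↦ s f)` a homomorphism.

It is continuous for the strong operator topology: for fixed `f` the map `(s, y) ↦ f (y s)` is
jointly continuous, so its curried form `S → C(Y, F)` is continuous, and the compact-open topology is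
the norm topology as `Y` is compact. Conversely, the strong operator topology controls the topology
of `S`: if `f` is the indicator function of a clopen set `K` with `ν s ∈ K` and `‖t f - s f‖ < 1`,
then evaluation at `ν 1` gives `|f (ν t) - f (ν s)| < 1`, that is `ν t ∈ K`, and the sets
`ν ⁻¹' K` form a basis of `S`.
-/

section TranslationOperator

variable {S : Type*} [Monoid S] {Y : Type*} [TopologicalSpace Y] [CompactSpace Y]
  [MulAction Sᵐᵒᵖ Y] [ContinuousConstSMul Sᵐᵒᵖ Y] (F : Type*) [NormedField F]

/-- The representation of `S` on `C(Y, F)` by the operators `(s f)(y) = f (y s)`, where the right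
action of `S` on `Y` is written as a left action of `Sᵐᵒᵖ`. -/
def translationHom : S →* ThetaLin F C(Y, F) where
  toFun s :=
    ⟨{ toFun := fun f => f.comp ⟨fun y => MulOpposite.op s • y, continuous_const_smul _⟩
       map_add' := fun _ _ => rfl
       map_smul' := fun _ _ => rfl },
      fun f g => (ContinuousMap.dist_le dist_nonneg).2 fun _ =>
        ContinuousMap.dist_apply_le_dist (f := f) (g := g) _⟩
  map_one' := by
    ext f y
    exact congrArg f (one_smul Sᵐᵒᵖ y)
  map_mul' s t := by
    ext f y
    exact congrArg f (mul_smul (MulOpposite.op t) (MulOpposite.op s) y)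

@[simp]
theorem translationHom_apply (s : S) (f : C(Y, F)) (y : Y) :
    (translationHom F s).1 f y = f (MulOpposite.op s • y) :=
  rfl

end TranslationOperator

theorem continuous_translationHom {S : Type*} [Monoid S] [TopologicalSpace S] {Y : Type*}
    [TopologicalSpace Y] [CompactSpace Y] [MulAction Sᵐᵒᵖ Y] [ContinuousSMul Sᵐᵒᵖ Y]
    (F : Type*) [NormedField F] :
    Continuous (translationHom F : S →* ThetaLin F C(Y, F)) := by
  refine continuous_induced_rng.2 (continuous_pi fun f => ?_)
  have hcont : Continuous fun p : S × Y => f (MulOpposite.op p.1 • p.2) := by fun_prop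
  exact (ContinuousMap.curry ⟨_, hcont⟩).continuous

/-- Indicator functions of clopen sets, evaluated at `ν 1`, recover the topology of `S` from the
strong operator topology. -/
theorem isInducing_translationHom {S : Type*} [Monoid S] [TopologicalSpace S] {Y : Type*}
    [TopologicalSpace Y] [CompactSpace Y] [MulAction Sᵐᵒᵖ Y] [ContinuousSMul Sᵐᵒᵖ Y]
    (F : Type*) [NormedField F] {ν : S → Y} (hν : IsInducing ν)
    (hν_smul : ∀ s x : S, ν (x * s) = MulOpposite.op s • ν x)
    (hY : TopologicalSpace.IsTopologicalBasis {U : Set Y | IsClopen U}) :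
    IsInducing (translationHom F : S →* ThetaLin F C(Y, F)) := by
  have orbit (s : S) : MulOpposite.op s • ν 1 = ν s := by rw [← hν_smul, one_mul]
  refine isInducing_iff_nhds.2 fun s => le_antisymm
    ((continuous_translationHom F).tendsto s).le_comap ?_
  rw [hν.nhds_eq_comap, ((hY.nhds_hasBasis).comap ν).ge_iff]
  rintro K ⟨hK, hsK⟩
  let f : C(Y, F) := (LocallyConstant.charFn F hK).toContinuousMap
  have hopen : IsOpen {σ : ThetaLin F C(Y, F) |
      dist (σ.1 f) ((translationHom F s).1 f) < 1} :=
    have heval : Continuous fun σ : ThetaLin F C(Y, F) => σ.1 f :=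
      (continuous_apply f).comp continuous_induced_dom
    isOpen_lt (heval.dist continuous_const) continuous_const
  refine Filter.mem_comap.2 ⟨_, hopen.mem_nhds (by simp), fun t ht => ?_⟩
  have hlt := (ContinuousMap.dist_apply_le_dist (ν 1)).trans_lt ht
  rw [translationHom_apply, translationHom_apply, orbit, orbit] at hlt
  by_contra htK
  simp only [Set.mem_preimage] at htK
  simp [f, LocallyConstant.coe_charFn, htK, hsK] at hlt

theorem proposition5 (S : Type u) [Monoid S] [TopologicalSpace S] [ContinuousMul S]
    (hS : IsRightNonarchimedean S)
    (F : Type v) [NormedField F] [IsUltrametricDist F] :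
    ∃ (V : Type (max u v)) (_ : NormedAddCommGroup V) (_ : NormedSpace F V)
      (_ : IsUltrametricDist V) (φ : S →* ThetaLin F V), IsEmbedding φ := by
  obtain ⟨-, Y, _, _, ν, hν⟩ := hS
  have := hν.stone.compact
  have := hν.stone.hausdorff
  have : ContinuousSMul Sᵐᵒᵖ Y := ⟨hν.continuous_action⟩
  have := hν.embedding.t2Space
  exact ⟨C(Y, F), inferInstance, inferInstance, inferInstance,
    translationHom F, (isInducing_translationHom F hν.embedding.isInducing
      (fun s x => hν.equivariant (MulOpposite.op s) x) hν.stone.zeroDimensional).isEmbedding⟩
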